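/- For every positive integer $t$ there is a constant $c>0$ such that the following holds. Let $G$ be a graph with no (not necessarily induced) subgraph isomorphic to $K_{t,t}$, and let $P=v_1v_2\cdots v_n$ be a path in $G$ of order $n\ge 5$. Then $G$ has an induced path $Q=v_{i_1}v_{i_2}\cdots v_{i_m}$ with $i_1<i_2<\cdots<i_m$ (that is, $Q$ is increasing along $P$) of order $$m\ \ge\ c\left(\frac{\log\log n}{\log\log\log n}\right)^{1/5}.$$ Here graphs are simple, undirected and loopless, the order of a path is its number of vertices, and logarithms are in base $2$. -/

import Mathlib

/-- `Q` is an induced path of order `m` in `G` (an induced copy of the path on `m` vertices) that is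
increasing along the path `P = v₀ v₁ … v₍ₙ₋₁₎`: the `i`-th vertex of `Q` is the `φ i`-th vertex of
`P`, for some strictly increasing `φ`. -/
def SimpleGraph.IsIncreasingAlong {V : Type*} {G : SimpleGraph V} {m n : ℕ}
    (Q : SimpleGraph.pathGraph m ↪g G) (P : SimpleGraph.Copy (SimpleGraph.pathGraph n) G) : Prop :=
  ∃ φ : Fin m → Fin n, StrictMono φ ∧ ∀ i : Fin m, Q i = P (φ i)

namespace SimpleGraph

/-! Identify vertices of `P` with their positions and suppose all increasing induced paths have
fewer than `K` edges. Shortest increasing walks are induced, hence short. `exists_left_sparse_set`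
grows a set `W` in rounds. Without `K_{t,t}`, few vertices have `t` neighbours in `W`, so a later
interval avoids them all. A shortest increasing walk from the current endpoint `a` to the start of
that interval is added to `W`, except for its end, which becomes the new endpoint. All of `W` still
reaches the endpoint, and left degrees stay at most `t + 2 * K`. A backward search of depth below
`K` from the endpoint therefore exhausts `W`, so `card_le_of_left_degree_le` bounds its size by `(t
+ 2 * K + 1) ^ K`; more rounds than that are contradictory. The rounds fit once `n` is doubly
exponential in `K ^ 2`, which gives order `√(log log n)`, more than is claimed. -/

/-- The edges of `H` inside `S`, oriented from the smaller to the larger endpoint. -/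
def IncreasingStep (H : SimpleGraph ℕ) (S : Set ℕ) (i j : ℕ) : Prop :=
  i < j ∧ H.Adj i j ∧ i ∈ S ∧ j ∈ S

/-- `f 0, …, f d` is an induced path of `H` that increases in the order of `ℕ`. -/
def IsInducedIncreasing (H : SimpleGraph ℕ) (f : ℕ → ℕ) (d : ℕ) : Prop :=
  ∀ i j, i < j → j ≤ d → f i < f j ∧ (H.Adj (f i) (f j) ↔ i + 1 = j)

/-! ### Increasing walks and induced paths. -/

lemma reflTransGen_increasingStep_mono {H : SimpleGraph ℕ} {S T : Set ℕ} (hST : S ⊆ T) {a b : ℕ}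
    (h : Relation.ReflTransGen (H.IncreasingStep S) a b) :
    Relation.ReflTransGen (H.IncreasingStep T) a b :=
  h.lift id fun _ _ h => ⟨h.1, h.2.1, hST h.2.2.1, hST h.2.2.2⟩

lemma exists_walk_of_reflTransGen {α : Type*} {r : α → α → Prop} {a b : α}
    (h : Relation.ReflTransGen r a b) :
    ∃ (d : ℕ) (f : ℕ → α), f 0 = a ∧ f d = b ∧ ∀ i < d, r (f i) (f (i + 1)) := by
  induction h using Relation.ReflTransGen.head_induction_on with
  | refl => exact ⟨0, fun _ => b, rfl, rfl, by simp⟩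
  | @head a c hac _ ih =>
    obtain ⟨d, f, h0, hd, hf⟩ := ih
    refine ⟨d + 1, fun i => Nat.casesOn i a f, rfl, hd, ?_⟩
    rintro (_ | i) hi
    · simpa [h0] using hac
    · exact hf i (by omega)

lemma reflTransGen_of_walk {α : Type*} {r : α → α → Prop} {f : ℕ → α} {d : ℕ}
    (hf : ∀ i < d, r (f i) (f (i + 1))) {i : ℕ} (hi : i ≤ d) :
    Relation.ReflTransGen r (f i) (f d) := by
  induction d, hi using Nat.le_induction with
  | base => exact .refl
  | succ d hd ih => exact (ih fun j hj => hf j (by omega)).tail (hf d (by omega))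

lemma lt_of_increasingStep {H : SimpleGraph ℕ} {S : Set ℕ} {f : ℕ → ℕ} {d : ℕ}
    (hf : ∀ i < d, H.IncreasingStep S (f i) (f (i + 1))) {i j : ℕ} (hij : i < j) (hj : j ≤ d) :
    f i < f j := by
  induction j, hij using Nat.le_induction with
  | base => exact (hf i (by omega)).1
  | succ j hij ih => exact (ih (by omega)).trans (hf j (by omega)).1

/-- A shortest increasing walk is an induced path. -/
lemma exists_induced_walk {H : SimpleGraph ℕ} {S : Set ℕ} {a b : ℕ}
    (h : Relation.ReflTransGen (H.IncreasingStep S) a b) :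
    ∃ (d : ℕ) (f : ℕ → ℕ), f 0 = a ∧ f d = b ∧
      (∀ i < d, H.IncreasingStep S (f i) (f (i + 1))) ∧ H.IsInducedIncreasing f d := by
  classical
  have hex := exists_walk_of_reflTransGen h
  obtain ⟨f, h0, hd, hf⟩ := Nat.find_spec hex
  set d := Nat.find hex with hdef
  refine ⟨d, f, h0, hd, hf, fun i j hij hj => ⟨lt_of_increasingStep hf hij hj, ?_, ?_⟩⟩
  · intro hadj
    by_contra hne
    have hshort : d - (j - i - 1) < d := by omega
    -- A chord from `f i` to `f j` shortcuts the walk, against minimality of `d`.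
    refine Nat.find_min hex hshort ⟨fun x => if x ≤ i then f x else f (x + (j - i - 1)), ?_, ?_, ?_⟩
    · simpa using h0
    · have : ¬ d - (j - i - 1) ≤ i := by omega
      simp only [this, if_false]
      rw [← hd]
      congr 1
      omega
    · intro x hx
      rcases lt_trichotomy x i with hxi | rfl | hxi
      · have h1 : x ≤ i := hxi.le
        have h2 : x + 1 ≤ i := hxi
        simpa only [h1, h2, if_true] using hf x (by omega)
      · have h2 : ¬ x + 1 ≤ x := by omega
        have h3 : x + 1 + (j - x - 1) = j := by omega
        simp only [le_refl, h2, if_true, if_false, h3]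
        refine ⟨lt_of_increasingStep hf hij hj, hadj, (hf x (by omega)).2.2.1, ?_⟩
        have := (hf (j - 1) (by omega)).2.2.2
        rwa [Nat.sub_add_cancel (by omega)] at this
      · have h1 : ¬ x ≤ i := by omega
        have h2 : ¬ x + 1 ≤ i := by omega
        have h3 : x + 1 + (j - i - 1) = x + (j - i - 1) + 1 := by omega
        simpa only [h1, h2, if_false, h3] using hf (x + (j - i - 1)) (by omega)
  · rintro rfl
    exact (hf i (by omega)).2.1

/-! ### Counting and pigeonhole bounds. -/

open Classical in
/-- If every vertex of `X` has at most `D` smaller neighbours in `X` and increasing induced paths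
in `X` have fewer than `K` edges, then few vertices of `X` are joined to `e` by increasing walks. -/
lemma card_le_of_left_degree_le {H : SimpleGraph ℕ} {X : Finset ℕ} {D K e : ℕ}
    (hdeg : ∀ x ∈ X, (X.filter fun y => y < x ∧ H.Adj y x).card ≤ D)
    (hreach : ∀ x ∈ X, Relation.ReflTransGen (H.IncreasingStep X) x e)
    (hK : ∀ f d, H.IsInducedIncreasing f d → (∀ i ≤ d, f i ≤ e) → d < K) :
    X.card ≤ (D + 1) ^ K := by
  rcases X.eq_empty_or_nonempty with rfl | ⟨x₀, hx₀⟩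
  · simp
  -- Backward search from `e`: `M i` is the ball of radius `i`. Keeping `x` itself turns the growth
  -- factor `D` into `D + 1`.
  let M : ℕ → Finset ℕ := fun i => Nat.rec {e}
    (fun _ A => A.biUnion fun x => insert x (X.filter fun y => y < x ∧ H.Adj y x)) i
  have hsucc : ∀ i, M (i + 1) =
      (M i).biUnion fun x => insert x (X.filter fun y => y < x ∧ H.Adj y x) := fun i => rfl
  have heX : e ∈ X := by
    rcases Relation.ReflTransGen.cases_tail (hreach x₀ hx₀) with h | ⟨c, -, hc⟩
    · rwa [h]
    · exact hc.2.2.2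
  have hMX : ∀ i, M i ⊆ X := by
    intro i
    induction i with
    | zero => simpa [M] using heX
    | succ i ih =>
      rw [hsucc, Finset.biUnion_subset]
      exact fun x hx => Finset.insert_subset (ih hx) (Finset.filter_subset _ _)
  have hcard : ∀ i, (M i).card ≤ (D + 1) ^ i := by
    intro i
    induction i with
    | zero => simp [M]
    | succ i ih =>
      rw [hsucc, pow_succ]
      refine (Finset.card_biUnion_le_card_mul _ _ (D + 1) fun x hx => ?_).trans
        (Nat.mul_le_mul_right _ ih)
      exact (Finset.card_insert_le _ _).trans (Nat.succ_le_succ (hdeg x (hMX i hx)))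
  have hmono : Monotone M := by
    refine monotone_nat_of_le_succ fun i x hx => ?_
    rw [hsucc, Finset.mem_biUnion]
    exact ⟨x, hx, Finset.mem_insert_self _ _⟩
  refine (Finset.card_le_card fun x hx => ?_).trans (hcard K)
  obtain ⟨d, f, h0, hd, hf, hind⟩ := exists_induced_walk (hreach x hx)
  have hdK : d < K := hK f d hind fun i hi => by
    rcases hi.lt_or_eq with h | rfl
    · exact hd ▸ (hind i d h le_rfl).1.le
    · exact hd.le
  have hmem : ∀ i ≤ d, f (d - i) ∈ M i := by
    intro i
    induction i with
    | zero => intro _; simp [M, hd]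
    | succ i ih =>
      intro hi
      have hs := hf (d - (i + 1)) (by omega)
      rw [show d - (i + 1) + 1 = d - i by omega] at hs
      rw [hsucc, Finset.mem_biUnion]
      refine ⟨_, ih (by omega), Finset.mem_insert_of_mem ?_⟩
      exact Finset.mem_filter.2 ⟨hs.2.2.1, hs.1, hs.2.1⟩
  have := hmem d le_rfl
  rw [Nat.sub_self, h0] at this
  exact hmono hdK.le this

open Classical in
/-- In a graph without `K_{t,t}`, few vertices have `t` neighbours in a given set. -/
lemma card_filter_le_of_no_biclique {α : Type*} {H : SimpleGraph α} {t : ℕ}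
    (hfree : ∀ A B : Finset α, A.card = t → B.card = t → ¬ ∀ a ∈ A, ∀ b ∈ B, H.Adj a b)
    (X I : Finset α) :
    (I.filter fun v => t ≤ (X.filter fun x => H.Adj x v).card).card ≤ t * X.card ^ t := by
  set bad := I.filter fun v => t ≤ (X.filter fun x => H.Adj x v).card
  by_contra! hlt
  -- Each bad vertex picks `t` neighbours in `X`; a `t`-set picked by more than `t` of them spans a
  -- biclique.
  have hsub : ∀ v ∈ bad, ∃ A ∈ X.powersetCard t, ∀ x ∈ A, H.Adj x v := by
    intro v hv
    obtain ⟨A, hA, hAt⟩ := Finset.exists_subset_card_eq (Finset.mem_filter.1 hv).2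
    exact ⟨A, Finset.mem_powersetCard.2 ⟨hA.trans (Finset.filter_subset _ _), hAt⟩,
      fun x hx => (Finset.mem_filter.1 (hA hx)).2⟩
  choose! g hg hgadj using hsub
  have hps : (X.powersetCard t).card * t < bad.card := by
    rw [Finset.card_powersetCard, mul_comm]
    exact (Nat.mul_le_mul_left _ (Nat.choose_le_pow _ _)).trans_lt hlt
  obtain ⟨A, hA, hAlt⟩ := Finset.exists_lt_card_fiber_of_mul_lt_card_of_maps_to hg hps
  obtain ⟨B, hB, hBt⟩ := Finset.exists_subset_card_eq hAlt.le
  refine hfree A B (Finset.mem_powersetCard.1 hA).2 hBt fun a ha b hb => ?_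
  obtain ⟨hb1, hb2⟩ := Finset.mem_filter.1 (hB hb)
  exact hgadj b hb1 a (hb2 ▸ ha)

/-- An interval of `(B + 1) * w` integers meeting a set of size at most `B` contains an interval
of length `w` that avoids the set. -/
lemma exists_interval_avoiding {B w s : ℕ} {bad : Finset ℕ} (hbad : bad.card ≤ B) (hw : 0 < w) :
    ∃ c, s ≤ c ∧ c + w ≤ s + (B + 1) * w ∧ ∀ v, c ≤ v → v < c + w → v ∉ bad := by
  by_contra! hcon
  have h : ∀ i ∈ Finset.range (B + 1), ∃ v ∈ bad, s + i * w ≤ v ∧ v < s + i * w + w := by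
    intro i hi
    obtain ⟨v, h1, h2, h3⟩ := hcon (s + i * w) (by omega) (by
      have := Nat.mul_le_mul_right w (Nat.succ_le_of_lt (Finset.mem_range.1 hi))
      rw [Nat.succ_mul] at this
      omega)
    exact ⟨v, h3, h1, h2⟩
  choose! g hg h1 h2 using h
  obtain ⟨i, hi, j, hj, hij, he⟩ := Finset.exists_ne_map_eq_of_card_lt_of_maps_to
    (by simpa using Nat.lt_succ_of_le hbad) hg
  have key : ∀ i ∈ Finset.range (B + 1), (g i - s) / w = i := by
    intro i hi
    have := h1 i hi
    have := h2 i hi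
    rw [Nat.div_eq_iff hw]
    constructor <;> omega
  exact hij (by rw [← key i hi, ← key j hj, he])

lemma reflTransGen_increasingStep_Icc {H : SimpleGraph ℕ} {n a c : ℕ}
    (hpath : ∀ i, i + 1 < n → H.Adj i (i + 1)) (hac : a ≤ c) (hc : c < n) :
    Relation.ReflTransGen (H.IncreasingStep (Set.Icc a c)) a c := by
  induction c, hac using Nat.le_induction with
  | base => exact .refl
  | succ c hac ih =>
    refine (reflTransGen_increasingStep_mono
      (Set.Icc_subset_Icc_right (by omega)) (ih (by omega))).tail ?_
    exact ⟨by omega, hpath c hc, ⟨hac, by omega⟩, ⟨by omega, le_rfl⟩⟩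

/-! ### The left-sparse set and the contradiction. -/

open Classical in
/-- If all increasing induced paths are short, then there is a long increasing connected set of
vertices in which every vertex has few smaller neighbours. -/
lemma exists_left_sparse_set {H : SimpleGraph ℕ} {n t K J B : ℕ}
    (hpath : ∀ i, i + 1 < n → H.Adj i (i + 1))
    (hfree : ∀ A B : Finset ℕ, A.card = t → B.card = t → ¬ ∀ a ∈ A, ∀ b ∈ B, H.Adj a b)
    (hK : ∀ f d, H.IsInducedIncreasing f d → (∀ i ≤ d, f i < n) → d < K)
    (hB : t * (J * K) ^ t ≤ B) (hn : (B + 2) ^ J ≤ n) {j : ℕ} (hj : j ≤ J) :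
    ∃ (W : Finset ℕ) (a : ℕ), a + (B + 2) ^ (J - j) ≤ n ∧ W.card ≤ j * K ∧ j ≤ W.card ∧
      (∀ x ∈ W, x < a) ∧
      (∀ v, a ≤ v → v < a + (B + 2) ^ (J - j) → (W.filter fun x => H.Adj x v).card ≤ t + K) ∧
      (∀ x ∈ W, (W.filter fun y => y < x ∧ H.Adj y x).card ≤ t + 2 * K) ∧
      ∀ x ∈ W, Relation.ReflTransGen (H.IncreasingStep (insert a W : Finset ℕ)) x a := by
  induction j with
  | zero => exact ⟨∅, 0, by simpa using hn, by simp⟩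
  | succ j ih =>
    obtain ⟨W, a, han, hWK, hjW, hlt, hnbr, hdeg, hreach⟩ := ih (by omega)
    obtain ⟨w, hw⟩ : ∃ w, w = (B + 2) ^ (J - (j + 1)) := ⟨_, rfl⟩
    have hw0 : 0 < w := hw ▸ by positivity
    -- Of the `B + 2` blocks, `B + 1` serve the pigeonhole; the last pays for starting at `a + 1`.
    have hww : (B + 2) ^ (J - j) = (B + 1) * w + w := by
      rw [show J - j = J - (j + 1) + 1 by omega, pow_succ, ← hw]
      ring
    rw [hww] at han hnbr
    rw [← hw]
    have hbad := (card_filter_le_of_no_biclique hfree W (Finset.range n)).trans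
      ((Nat.mul_le_mul_left t (Nat.pow_le_pow_left
        (hWK.trans (Nat.mul_le_mul_right K (by omega : j ≤ J))) t)).trans hB)
    -- Since `c > a`, the walk is nontrivial and `a` itself joins the set, so each round enlarges
    -- it.
    obtain ⟨c, hac, hcw, hgood⟩ := exists_interval_avoiding (s := a + 1) hbad hw0
    obtain ⟨d, f, h0, hd, hf, hind⟩ :=
      exists_induced_walk (reflTransGen_increasingStep_Icc hpath (by omega : a ≤ c) (by omega))
    have hfIcc : ∀ i ≤ d, a ≤ f i ∧ f i ≤ c := by
      intro i hi
      constructor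
      · rcases Nat.eq_zero_or_pos i with rfl | hi0
        · exact h0.ge
        · exact h0 ▸ (hind 0 i hi0 hi).1.le
      · rcases hi.lt_or_eq with h | rfl
        · exact hd ▸ (hind i d h le_rfl).1.le
        · exact hd.le
    have hdK : d < K := hK f d hind fun i hi => by have := hfIcc i hi; omega
    have hd0 : 0 < d := by
      rcases Nat.eq_zero_or_pos d with rfl | h
      · omega
      · exact h
    obtain ⟨Y, hY⟩ : ∃ Y, Y = (Finset.range d).image f := ⟨_, rfl⟩
    have hYcard : Y.card ≤ K := hY ▸ Finset.card_image_le.trans (by simpa using hdK.le)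
    have hYmem : ∀ i < d, f i ∈ Y := fun i hi =>
      hY ▸ Finset.mem_image_of_mem _ (Finset.mem_range.2 hi)
    have hYlt : ∀ x ∈ Y, a ≤ x ∧ x < c := by
      intro x hx
      obtain ⟨i, hi, rfl⟩ := Finset.mem_image.1 (hY ▸ hx)
      have hi := Finset.mem_range.1 hi
      exact ⟨(hfIcc i hi.le).1, hd ▸ (hind i d hi le_rfl).1⟩
    have hstep : ∀ i < d, H.IncreasingStep (insert c (W ∪ Y) : Finset ℕ) (f i) (f (i + 1)) := by
      intro i hi
      have hmem : ∀ i ≤ d, f i ∈ ((insert c (W ∪ Y) : Finset ℕ) : Set ℕ) := by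
        intro i hi
        rcases hi.lt_or_eq with h | rfl
        · exact Finset.mem_insert_of_mem (Finset.mem_union_right _ (hYmem i h))
        · exact hd ▸ Finset.mem_insert_self _ _
      exact ⟨(hf i hi).1, (hf i hi).2.1, hmem i hi.le, hmem (i + 1) hi⟩
    have hYreach : ∀ i ≤ d, Relation.ReflTransGen
        (H.IncreasingStep (insert c (W ∪ Y) : Finset ℕ)) (f i) c := fun i hi =>
      hd ▸ reflTransGen_of_walk (hd ▸ hstep) hi
    refine ⟨W ∪ Y, c, by omega, ?_, ?_, ?_, ?_, ?_, ?_⟩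
    · rw [Nat.succ_mul]
      exact (Finset.card_union_le _ _).trans (by omega)
    · have haW : a ∉ W := fun h => (hlt a h).false
      have hsub : insert a W ⊆ W ∪ Y := Finset.insert_subset
        (Finset.mem_union_right _ (h0 ▸ hYmem 0 hd0)) Finset.subset_union_left
      have := Finset.card_le_card hsub
      rw [Finset.card_insert_of_notMem haW] at this
      omega
    · intro x hx
      rcases Finset.mem_union.1 hx with h | h
      · have := hlt x h
        omega
      · exact (hYlt x h).2
    · intro v hcv hv
      have hvn : v ∈ Finset.range n := Finset.mem_range.2 (by omega)
      have hlt_t : (W.filter fun x => H.Adj x v).card < t := by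
        by_contra! h
        exact hgood v hcv hv (Finset.mem_filter.2 ⟨hvn, h⟩)
      rw [Finset.filter_union]
      refine (Finset.card_union_le _ _).trans (add_le_add hlt_t.le ?_)
      exact (Finset.card_filter_le _ _).trans hYcard
    · intro x hx
      rcases Finset.mem_union.1 hx with h | h
      -- `Y` lies to the right of `W`, so old left degrees do not change.
      · refine (Finset.card_le_card fun y hy => ?_).trans (hdeg x h)
        obtain ⟨hy, hyx⟩ := Finset.mem_filter.1 hy
        refine Finset.mem_filter.2 ⟨(Finset.mem_union.1 hy).resolve_right fun hy' => ?_, hyx⟩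
        have h1 := (hYlt y hy').1
        have h2 := hlt x h
        have h3 := hyx.1
        omega
      · have hx' := hYlt x h
        rw [Finset.filter_union]
        refine (Finset.card_union_le _ _).trans ?_
        have h1 : (W.filter fun y => y < x ∧ H.Adj y x).card ≤ t + K :=
          (Finset.card_le_card (Finset.monotone_filter_right _ fun y _ hy => hy.2)).trans
            (hnbr x hx'.1 (by omega))
        have h2 := (Finset.card_filter_le Y fun y => y < x ∧ H.Adj y x).trans hYcard
        omega
    · intro x hx
      rcases Finset.mem_union.1 hx with h | h
      · refine (reflTransGen_increasingStep_mono ?_ (hreach x h)).trans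
          (h0 ▸ hYreach 0 hd0.le)
        refine Finset.coe_subset.2 (Finset.insert_subset ?_ fun y hy => ?_)
        · exact Finset.mem_insert_of_mem (Finset.mem_union_right _ (h0 ▸ hYmem 0 hd0))
        · exact Finset.mem_insert_of_mem (Finset.mem_union_left _ hy)
      · obtain ⟨i, hi, rfl⟩ := Finset.mem_image.1 (hY ▸ h)
        exact hYreach i (Finset.mem_range.1 hi).le

/-- A `K_{t,t}`-free graph on a long path contains an increasing induced path with `K` edges. -/
lemma exists_isInducedIncreasing {H : SimpleGraph ℕ} {n t K J : ℕ}
    (hpath : ∀ i, i + 1 < n → H.Adj i (i + 1))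
    (hfree : ∀ A B : Finset ℕ, A.card = t → B.card = t → ¬ ∀ a ∈ A, ∀ b ∈ B, H.Adj a b)
    (hJ : (t + 2 * K + 1) ^ K < J) (hn : (t * (J * K) ^ t + 2) ^ J ≤ n) :
    ∃ f d, H.IsInducedIncreasing f d ∧ (∀ i ≤ d, f i < n) ∧ K ≤ d := by
  classical
  by_contra! hcon
  obtain ⟨W, a, han, -, hJW, hlt, hnbr, hdeg, hreach⟩ :=
    exists_left_sparse_set hpath hfree hcon le_rfl hn (le_refl J)
  rw [Nat.sub_self, pow_zero] at han hnbr
  have hcard : (insert a W).card ≤ (t + 2 * K + 1) ^ K := by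
    refine card_le_of_left_degree_le (H := H) (e := a) ?_ ?_ fun f d hf hfa =>
      hcon f d hf fun i hi => (hfa i hi).trans_lt (by omega)
    · intro x hx
      rcases Finset.mem_insert.1 hx with rfl | hxW
      · rw [Finset.filter_insert, if_neg (by simp)]
        have := (Finset.card_le_card (Finset.monotone_filter_right W
          fun y _ (hy : y < x ∧ H.Adj y x) => hy.2)).trans (hnbr x le_rfl (by omega))
        omega
      · rw [Finset.filter_insert, if_neg fun h => (hlt x hxW).not_gt h.1]
        exact hdeg x hxW
    · intro x hx
      rcases Finset.mem_insert.1 hx with rfl | hxW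
      · exact .refl
      · exact hreach x hxW
  have := Finset.card_le_card (Finset.subset_insert a W)
  omega

/-! ### Numerical estimate. -/

/-- A doubly exponential path length suffices for an increasing induced path with `K` edges. -/
lemma tower_bound {t K : ℕ} (ht : 1 ≤ t) (hK : 1 ≤ K) :
    (t * (((t + 2 * K + 1) ^ K + 1) * K) ^ t + 2) ^ ((t + 2 * K + 1) ^ K + 1) ≤
      2 ^ 2 ^ (10 * (t + 3) ^ 2 * K ^ 2) := by
  obtain ⟨s, hs⟩ : ∃ s, s = t + 3 := ⟨_, rfl⟩
  rw [← hs]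
  set J := (t + 2 * K + 1) ^ K + 1 with hJdef
  have hJ : J ≤ 2 ^ (2 * s * K ^ 2) := by
    have h1 : t + 2 * K + 1 ≤ 2 ^ (s * K) :=
      (by rw [hs]; nlinarith : t + 2 * K + 1 ≤ s * K).trans Nat.lt_two_pow_self.le
    have h2 : (t + 2 * K + 1) ^ K ≤ 2 ^ (s * K ^ 2) :=
      (Nat.pow_le_pow_left h1 K).trans (by rw [← pow_mul]; exact (by ring_nf; exact le_rfl))
    have h3 : 1 ≤ s * K ^ 2 := Nat.mul_pos (by omega) (by positivity)
    have h4 : 2 ^ (s * K ^ 2) + 1 ≤ 2 ^ (s * K ^ 2 + 1) := by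
      rw [pow_succ 2 (s * K ^ 2)]
      have := Nat.one_le_two_pow (n := s * K ^ 2)
      omega
    exact (Nat.succ_le_succ h2).trans (h4.trans (Nat.pow_le_pow_right (by norm_num) (by nlinarith)))
  have hKK : K ≤ K ^ 2 := Nat.le_self_pow (by norm_num) K
  have hJK : J * K ≤ 2 ^ (3 * s * K ^ 2) := by
    refine (Nat.mul_le_mul hJ Nat.lt_two_pow_self.le).trans ?_
    rw [← pow_add]
    exact Nat.pow_le_pow_right (by norm_num) (by nlinarith)
  have hts : t ≤ s := by omega
  have hB : t * (J * K) ^ t + 2 ≤ 2 ^ (5 * s ^ 2 * K ^ 2) := by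
    have h1 : (J * K) ^ t ≤ 2 ^ (3 * s ^ 2 * K ^ 2) := by
      refine (Nat.pow_le_pow_left hJK t).trans ?_
      rw [← pow_mul]
      refine Nat.pow_le_pow_right (by norm_num) ?_
      calc 3 * s * K ^ 2 * t ≤ 3 * s * K ^ 2 * s := Nat.mul_le_mul_left _ hts
        _ = 3 * s ^ 2 * K ^ 2 := by ring
    have h2 : (t + 2) * 2 ^ (3 * s ^ 2 * K ^ 2) ≤ 2 ^ (5 * s ^ 2 * K ^ 2) := by
      refine (Nat.mul_le_mul_right _
        ((by omega : t + 2 ≤ s).trans Nat.lt_two_pow_self.le)).trans ?_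
      rw [← pow_add]
      refine Nat.pow_le_pow_right (by norm_num) ?_
      have : s ≤ s ^ 2 * K ^ 2 := (Nat.le_self_pow (by norm_num) s).trans
        (Nat.le_mul_of_pos_right _ (by positivity))
      nlinarith
    have h3 := Nat.one_le_two_pow (n := 3 * s ^ 2 * K ^ 2)
    have h4 := Nat.mul_le_mul_left t h1
    rw [add_mul] at h2
    omega
  refine (Nat.pow_le_pow_left hB J).trans ?_
  rw [← pow_mul]
  refine Nat.pow_le_pow_right (by norm_num) ?_
  refine (Nat.mul_le_mul Nat.lt_two_pow_self.le hJ).trans ?_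
  rw [← pow_add]
  refine Nat.pow_le_pow_right (by norm_num) ?_
  have : s * K ^ 2 ≤ s ^ 2 * K ^ 2 := Nat.mul_le_mul_right _ (Nat.le_self_pow (by norm_num) s)
  nlinarith

/-! ### Passing between `G` and positions on `P`. -/

/-- The graph on `ℕ` whose edges are those induced by `G` on the positions along `P`. -/
def positionGraph {V : Type*} {G : SimpleGraph V} {n : ℕ} (P : Copy (pathGraph n) G) :
    SimpleGraph ℕ where
  Adj i j := ∃ (hi : i < n) (hj : j < n), G.Adj (P ⟨i, hi⟩) (P ⟨j, hj⟩)
  symm := ⟨fun _ _ ⟨hi, hj, h⟩ => ⟨hj, hi, h.symm⟩⟩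
  loopless := ⟨fun _ ⟨_, _, h⟩ => G.irrefl h⟩

variable {V : Type*} {G : SimpleGraph V} {n : ℕ}

lemma positionGraph_adj_succ (P : Copy (pathGraph n) G) (i : ℕ) (hi : i + 1 < n) :
    (positionGraph P).Adj i (i + 1) :=
  ⟨by omega, hi, P.toHom.map_adj (pathGraph_adj.2 (Or.inl rfl))⟩

lemma positionGraph_no_biclique (P : Copy (pathGraph n) G) {t : ℕ} (ht : 1 ≤ t)
    (hfree : (completeBipartiteGraph (Fin t) (Fin t)).Free G) (A B : Finset ℕ)
    (hA : A.card = t) (hB : B.card = t) : ¬ ∀ a ∈ A, ∀ b ∈ B, (positionGraph P).Adj a b := by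
  intro hAB
  let α := A.orderEmbOfFin hA
  let β := B.orderEmbOfFin hB
  have hadj : ∀ i j, (positionGraph P).Adj (α i) (β j) := fun i j =>
    hAB _ (A.orderEmbOfFin_mem hA i) _ (B.orderEmbOfFin_mem hB j)
  have hα : ∀ i, α i < n := fun i => (hadj i ⟨0, ht⟩).1
  have hβ : ∀ j, β j < n := fun j => (hadj ⟨0, ht⟩ j).2.1
  let g : Fin t ⊕ Fin t → Fin n := Sum.elim (fun i => ⟨α i, hα i⟩) fun j => ⟨β j, hβ j⟩
  have hg : Function.Injective g := by
    refine Function.Injective.sumElim (fun i j h => ?_) (fun i j h => ?_) fun i j h => ?_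
    · exact α.injective (congrArg Fin.val h)
    · exact β.injective (congrArg Fin.val h)
    -- Complete adjacency already forces `A` and `B` to be disjoint.
    · exact (hadj i j).ne (congrArg Fin.val h)
  refine hfree ⟨⟨⟨fun x => P (g x), ?_⟩, fun x y h => hg (P.injective h)⟩⟩
  rintro (i | i) (j | j) h
  · simp at h
  · exact (hadj i j).2.2
  · exact (hadj j i).2.2.symm
  · simp at h

/-- An increasing induced path in the graph of positions is one along `P`. -/
lemma exists_isIncreasingAlong (P : Copy (pathGraph n) G) {f : ℕ → ℕ} {d : ℕ}
    (hf : (positionGraph P).IsInducedIncreasing f d) (hfn : ∀ i ≤ d, f i < n) :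
    ∃ Q : pathGraph (d + 1) ↪g G, IsIncreasingAlong Q P := by
  let φ : Fin (d + 1) → Fin n := fun i => ⟨f i, hfn i (by omega)⟩
  have hφ : StrictMono φ := fun i j hij => (hf i j hij (by omega)).1
  have key : ∀ i j : Fin (d + 1), i < j → (G.Adj (P (φ i)) (P (φ j)) ↔ i.val + 1 = j.val) := by
    intro i j hij
    rw [← (hf i j hij (by omega)).2]
    exact ⟨fun h => ⟨_, _, h⟩, fun h => h.2.2⟩
  refine ⟨⟨⟨fun i => P (φ i), fun i j h => hφ.injective (P.injective h)⟩, ?_⟩, φ, hφ, fun _ => rfl⟩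
  intro i j
  change G.Adj (P (φ i)) (P (φ j)) ↔ _
  rw [pathGraph_adj]
  rcases lt_trichotomy i j with h | rfl | h
  · rw [key i j h]
    omega
  · simp
  · rw [G.adj_comm, key j i h]
    omega

/-! ### Asymptotics. -/

/-- The order of increasing induced paths grows at least like `√(log log n)`. -/
lemma exists_increasing_sqrt_loglog {t : ℕ} (ht : 1 ≤ t)
    (hfree : (completeBipartiteGraph (Fin t) (Fin t)).Free G) (hn : 5 ≤ n)
    (P : Copy (pathGraph n) G) :
    ∃ (m : ℕ) (Q : pathGraph m ↪g G),
      Real.logb 2 (Real.logb 2 n) ≤ 10 * (t + 3) ^ 2 * (m : ℝ) ^ 2 ∧ IsIncreasingAlong Q P := by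
  obtain ⟨C, hC⟩ : ∃ C, C = 10 * (t + 3) ^ 2 := ⟨_, rfl⟩
  -- `K` is the last scale reached by `n`; for `K = 0` a single vertex suffices.
  obtain ⟨K, hnK, hKn⟩ : ∃ K, n < 2 ^ 2 ^ (C * (K + 1) ^ 2) ∧ (1 ≤ K → 2 ^ 2 ^ (C * K ^ 2) ≤ n) := by
    have hex : ∃ K, n < 2 ^ 2 ^ (C * (K + 1) ^ 2) := by
      refine ⟨n, (Nat.lt_two_pow_self (n := n)).trans_le (Nat.pow_le_pow_right (by norm_num) ?_)⟩
      refine Nat.lt_two_pow_self.le.trans (Nat.pow_le_pow_right (by norm_num) ?_)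
      have hC1 : 1 ≤ C := by rw [hC]; nlinarith
      nlinarith [Nat.mul_le_mul_right ((n + 1) ^ 2) hC1]
    refine ⟨Nat.find hex, Nat.find_spec hex, fun h1 => ?_⟩
    have := Nat.find_min hex (Nat.sub_lt h1 one_pos)
    rwa [Nat.sub_add_cancel h1, not_lt] at this
  obtain ⟨f, d, hf, hfn, hKd⟩ : ∃ f d, (positionGraph P).IsInducedIncreasing f d ∧
      (∀ i ≤ d, f i < n) ∧ K ≤ d := by
    rcases Nat.eq_zero_or_pos K with rfl | hK
    · exact ⟨id, 0, fun i j hij hj => by omega, fun i hi => by simp; omega, le_rfl⟩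
    · exact exists_isInducedIncreasing (positionGraph_adj_succ P)
        (positionGraph_no_biclique P ht hfree) (Nat.lt_succ_self _)
        ((tower_bound ht hK).trans (hC ▸ hKn hK))
  obtain ⟨Q, hQ⟩ := exists_isIncreasingAlong P hf hfn
  refine ⟨d + 1, Q, ?_, hQ⟩
  have h1 : Real.logb 2 n ≤ (2 : ℝ) ^ (C * (K + 1) ^ 2) := by
    rw [Real.logb_le_iff_le_rpow (by norm_num) (by positivity)]
    exact_mod_cast hnK.le
  have h0 : 0 < Real.logb 2 n :=
    Real.logb_pos (by norm_num) (by exact_mod_cast (by omega : 1 < n))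
  have h2 : Real.logb 2 (Real.logb 2 n) ≤ ((C * (K + 1) ^ 2 : ℕ) : ℝ) := by
    rw [Real.logb_le_iff_le_rpow (by norm_num) h0, Real.rpow_natCast]
    exact h1
  refine h2.trans ?_
  have h3 : C * (K + 1) ^ 2 ≤ 10 * (t + 3) ^ 2 * (d + 1) ^ 2 := by
    rw [hC]
    gcongr
  exact_mod_cast h3

lemma logb_logb_pos {x : ℝ} (hx : 5 ≤ x) :
    1 < Real.logb 2 (Real.logb 2 x) ∧ 2 < Real.logb 2 x := by
  have h1 : 2 < Real.logb 2 x := by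
    rw [Real.lt_logb_iff_rpow_lt (by norm_num) (by linarith)]
    norm_num
    linarith
  refine ⟨?_, h1⟩
  rw [Real.lt_logb_iff_rpow_lt (by norm_num) (by linarith)]
  simpa using h1

end SimpleGraph

theorem theorem1p2 (t : ℕ) (ht : 1 ≤ t) :
    ∃ c : ℝ, 0 < c ∧
      ∀ (V : Type*) (G : SimpleGraph V),
        (completeBipartiteGraph (Fin t) (Fin t)).Free G →
        ∀ n : ℕ, 5 ≤ n →
        ∀ P : SimpleGraph.Copy (SimpleGraph.pathGraph n) G,
          ∃ (m : ℕ) (Q : SimpleGraph.pathGraph m ↪g G),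
            c * (Real.logb 2 (Real.logb 2 n) / Real.logb 2 (Real.logb 2 (Real.logb 2 n)))
                ^ (1 / 5 : ℝ) ≤ (m : ℝ) ∧
            SimpleGraph.IsIncreasingAlong Q P := by
  -- The value at `n = 5` bounds the triple logarithm below, so the division costs only a constant.
  set ε := Real.logb 2 (Real.logb 2 (Real.logb 2 5)) with hε
  have hε0 : 0 < ε := Real.logb_pos (by norm_num) (SimpleGraph.logb_logb_pos le_rfl).1
  set A : ℝ := 10 * (t + 3) ^ 2 / ε with hA
  have hA0 : 0 < A := by positivity
  refine ⟨(A ^ (1 / 5 : ℝ))⁻¹, by positivity, fun V G hfree n hn P => ?_⟩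
  obtain ⟨m, Q, hm, hQ⟩ := SimpleGraph.exists_increasing_sqrt_loglog ht hfree hn P
  refine ⟨m, Q, ?_, hQ⟩
  have hn5 : (5 : ℝ) ≤ n := by exact_mod_cast hn
  obtain ⟨hL, hl⟩ := SimpleGraph.logb_logb_pos hn5
  obtain ⟨hL5, hl5⟩ := SimpleGraph.logb_logb_pos le_rfl
  set L := Real.logb 2 (Real.logb 2 n)
  have hεL : ε ≤ Real.logb 2 L :=
    Real.logb_le_logb_of_le (by norm_num) (by linarith)
      (Real.logb_le_logb_of_le (by norm_num) (by linarith)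
        (Real.logb_le_logb_of_le (by norm_num) (by norm_num) hn5))
  have hm1 : (1 : ℝ) ≤ m := by
    rcases Nat.eq_zero_or_pos m with rfl | h
    · norm_num at hm
      linarith
    · exact_mod_cast h
  have hratio : L / Real.logb 2 L ≤ A * (m : ℝ) ^ 5 := calc
    L / Real.logb 2 L ≤ L / ε := div_le_div_of_nonneg_left (by linarith) hε0 hεL
    _ ≤ 10 * (t + 3) ^ 2 * (m : ℝ) ^ 2 / ε := by gcongr
    _ = A * (m : ℝ) ^ 2 := by rw [hA]; ring
    -- The exponent `1 / 5` is reached by weakening the square, as `m ≥ 1`.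
    _ ≤ A * (m : ℝ) ^ 5 := by gcongr; norm_num
  have hroot : (L / Real.logb 2 L) ^ (1 / 5 : ℝ) ≤ A ^ (1 / 5 : ℝ) * m := by
    refine (Real.rpow_le_rpow (div_nonneg (by linarith) (by linarith)) hratio (by norm_num)).trans ?_
    rw [Real.mul_rpow hA0.le (by positivity), ← Real.rpow_natCast_mul (by positivity)]
    norm_num
  rwa [inv_mul_le_iff₀ (by positivity)]
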